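/- All topological groups are understood to be Hausdorff. A $k_\omega$-space is a Hausdorff space $X$ that is the union of an ascending sequence $K_1\subseteq K_2\subseteq\cdots$ of compact subsets such that $U\subseteq X$ is open if and only if $U\cap K_n$ is open in $K_n$ for every $n$. A Hausdorff space is locally $k_\omega$ if each of its points has an open neighbourhood that is a $k_\omega$-space in the induced topology, and a topological group is called locally $k_\omega$ if its underlying space is. A Hausdorff space $X$ is almost metrizable if each $x\in X$ lies in a compact set $K\subseteq X$ that has a countable basis $(U_n)_{n\in\mathbb N}$ of neighbourhoods in $X$, that is, $K\subseteq U_n^0$ for all $n$, and for each $U\subseteq X$ with $K\subseteq U^0$ there is $n$ with $U_n\subseteq U$ (where $U^0$ is the interior of $U$). A topological space is Čech complete if it is homeomorphic to the intersection of a sequence of open subsets of a compact Hausdorff space. A topological group is complete if it is complete in its left uniform structure. For an abelian topological group $G$, let $G^*$ be its Pontryagin dual, the group of all continuous homomorphisms $G\to\mathbb T=\{z\in\mathbb C:|z|=1\}$ with the compact-open topology. **Proposition.** Let $G$ be an abelian Hausdorff topological group. 1. If $G$ is locally $k_\omega$, then $G^*$ is Čech complete, and hence almost metrizable and complete. 2.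 If $G$ is almost metrizable, then $G^*$ is locally $k_\omega$ and complete. -/

import Mathlib

/-- A `k_ω`-space: a Hausdorff space `X` which is the union of an ascending sequence of compact
subsets `K n` such that a subset of `X` is open if and only if its trace on every `K n` is open
in `K n`. -/
def IsKOmegaSpace (X : Type*) [TopologicalSpace X] : Prop :=
  T2Space X ∧ ∃ K : ℕ → Set X, Monotone K ∧ (∀ n, IsCompact (K n)) ∧ (⋃ n, K n) = Set.univ ∧
    ∀ U : Set X, IsOpen U ↔ ∀ n, IsOpen ((Subtype.val : K n → X) ⁻¹' U)

/-- A locally `k_ω` space: a Hausdorff space in which every point has an open neighbourhood that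
is a `k_ω`-space in the induced topology. -/
def IsLocallyKOmegaSpace (X : Type*) [TopologicalSpace X] : Prop :=
  T2Space X ∧ ∀ x : X, ∃ U : Set X, IsOpen U ∧ x ∈ U ∧ IsKOmegaSpace U

/-- An almost metrizable space: a Hausdorff space in which every point lies in a compact set `K`
that has a countable basis `(U n)` of neighbourhoods. -/
def IsAlmostMetrizable (X : Type*) [TopologicalSpace X] : Prop :=
  T2Space X ∧ ∀ x : X, ∃ K : Set X, x ∈ K ∧ IsCompact K ∧
    ∃ U : ℕ → Set X, (∀ n, K ⊆ interior (U n)) ∧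
      ∀ V : Set X, K ⊆ interior V → ∃ n, U n ⊆ V

/-- A Čech complete space: a space homeomorphic to the intersection of a sequence of open subsets
of a compact Hausdorff space. (Replacing the compact space by the closure of the image, whose
cardinality is at most `2 ^ 2 ^ #X`, one may take it in the universe of `X`.) -/
def IsCechComplete.{u} (X : Type u) [TopologicalSpace X] : Prop :=
  ∃ (Y : Type u) (_ : TopologicalSpace Y) (_ : CompactSpace Y) (_ : T2Space Y) (f : X → Y),
    Topology.IsEmbedding f ∧
      ∃ U : ℕ → Set Y, (∀ n, IsOpen (U n)) ∧ Set.range f = ⋂ n, U n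

/-- A topological group is complete if it is complete in its left uniform structure. -/
def IsCompleteTopGroup (G : Type*) [Group G] [TopologicalSpace G] [IsTopologicalGroup G] : Prop :=
  @CompleteSpace G (IsTopologicalGroup.leftUniformSpace G)

/-!
Under either hypothesis `G` is compactly coherent, so `G* = Hom(G, 𝕋)` is closed in the complete
group `C(G, 𝕋)`.

If `1` has a `k_ω` neighbourhood exhausted by compact sets `K n`, then an ultrafilter on `G*` which
for every `n` contains a ball of radius `1 / (n + 1)` on `K n` is Cauchy on each `K n`; it is
pointwise Cauchy because `𝕋` is compact, hence by translation Cauchy uniformly on every compact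
set, and so it converges. Countably many covers of a completely regular space with this property
cut it out of its Stone–Čech compactification as a `G_δ` set.

If `1` lies in a compact set `K` with a decreasing countable basis `B n` of neighbourhoods, the
characters that are positive on `K` form an open neighbourhood of the trivial character, exhausted
by the polars of the `B n`. These are compact by Ascoli's theorem, since the right half of the
circle contains no nontrivial subgroup. As in the Banach–Dieudonné theorem, a set `Z` with closed
traces on all the polars can be separated from a character outside it by testing on finite sets
`A n ⊆ B n`, and their union with `K` is again compact; so the polars determine the topology.
-/

open Topology Filter Set UniformConvergence

theorem isCechComplete_of_ultrafilter.{u} {X : Type u} [TopologicalSpace X] [T35Space X]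
    (V : ℕ → X → Set X) (hV : ∀ n x, V n x ∈ 𝓝 x)
    (h : ∀ F : Ultrafilter X, (∀ n, ∃ x, V n x ∈ F) → ∃ x, (F : Filter X) ≤ 𝓝 x) :
    IsCechComplete X := by
  have he : IsDenseEmbedding (stoneCechUnit : X → StoneCech X) := isDenseEmbedding_stoneCechUnit
  refine ⟨StoneCech X, inferInstance, inferInstance, inferInstance, stoneCechUnit,
    he.isEmbedding, fun n ↦ ⋃₀ {W | IsOpen W ∧ ∃ x, stoneCechUnit ⁻¹' W ⊆ V n x},
    fun n ↦ isOpen_sUnion fun W hW ↦ hW.1, Subset.antisymm ?_ fun y hy ↦ ?_⟩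
  · rintro _ ⟨x, rfl⟩
    refine mem_iInter.2 fun n ↦ ?_
    obtain ⟨W, hW, hWV⟩ := he.isInducing.isOpen_iff.1 (isOpen_interior (s := V n x))
    have hx : x ∈ stoneCechUnit ⁻¹' W := hWV ▸ mem_interior_iff_mem_nhds.2 (hV n x)
    exact ⟨W, ⟨hW, x, hWV.trans_subset interior_subset⟩, hx⟩
  · have := he.comap_nhds_neBot y
    obtain ⟨F, hF⟩ := Ultrafilter.exists_le (comap (stoneCechUnit : X → StoneCech X) (𝓝 y))
    have hFV : ∀ n, ∃ x, V n x ∈ F := fun n ↦ by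
      obtain ⟨W, ⟨hW, x, hWx⟩, hyW⟩ := mem_iInter.1 hy n
      exact ⟨x, mem_of_superset (hF (preimage_mem_comap (hW.mem_nhds hyW))) hWx⟩
    obtain ⟨x, hx⟩ := h F hFV
    exact ⟨x, tendsto_nhds_unique (l := (F : Filter X))
      ((he.continuous.tendsto x).mono_left hx) (tendsto_iff_comap.2 hF)⟩

theorem exists_isClosed_seq_subset_interior {X : Type*} [TopologicalSpace X] [RegularSpace X]
    {x : X} {U : ℕ → Set X} (hU : ∀ n, U n ∈ 𝓝 x) :
    ∃ W : ℕ → Set X, (∀ n, W n ∈ 𝓝 x) ∧ (∀ n, IsClosed (W n)) ∧ (∀ n, W n ⊆ U n) ∧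
      ∀ n, W (n + 1) ⊆ interior (W n) := by
  have hshrink : ∀ s ∈ 𝓝 x, ∃ t ∈ 𝓝 x, IsClosed t ∧ t ⊆ s :=
    fun s hs ↦ exists_mem_nhds_isClosed_subset hs
  choose! c hcx hcc hcs using hshrink
  let W : ℕ → Set X := fun n ↦ n.rec (c (U 0)) fun k w ↦ c (U (k + 1) ∩ interior w)
  have hW : ∀ n, W n ∈ 𝓝 x := fun n ↦ by
    induction n with
    | zero => exact hcx _ (hU 0)
    | succ k ih => exact hcx _ (inter_mem (hU _) (interior_mem_nhds.2 ih))
  have hUW : ∀ n, U (n + 1) ∩ interior (W n) ∈ 𝓝 x :=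
    fun n ↦ inter_mem (hU _) (interior_mem_nhds.2 (hW n))
  refine ⟨W, hW, fun n ↦ ?_, fun n ↦ ?_, fun n ↦ (hcs _ (hUW n)).trans inter_subset_right⟩
  · cases n with
    | zero => exact hcc _ (hU 0)
    | succ k => exact hcc _ (hUW k)
  · cases n with
    | zero => exact hcs _ (hU 0)
    | succ k => exact (hcs _ (hUW k)).trans inter_subset_left

theorem hasBasis_nhdsSet_iInter {X : Type*} [TopologicalSpace X] [CompactSpace X]
    {W : ℕ → Set X} (hW : ∀ n, IsClosed (W n)) (hWi : ∀ n, W (n + 1) ⊆ interior (W n)) :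
    (𝓝ˢ (⋂ n, W n)).HasBasis (fun _ ↦ True) W := by
  refine ⟨fun S ↦ ⟨fun hS ↦ ?_, fun ⟨n, _, hn⟩ ↦ mem_of_superset ?_ hn⟩⟩
  · have hanti : Antitone W := antitone_nat_of_succ_le fun n ↦ (hWi n).trans interior_subset
    obtain ⟨n, hn⟩ := exists_subset_nhds_of_isCompact' hanti.directed_ge
      (fun n ↦ (hW n).isCompact) hW (mem_nhdsSet_iff_forall.1 hS)
    exact ⟨n, trivial, hn⟩
  · exact subset_interior_iff_mem_nhdsSet.1 ((iInter_subset W (n + 1)).trans (hWi n))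

theorem IsCechComplete.isAlmostMetrizable {X : Type*} [TopologicalSpace X]
    (hX : IsCechComplete X) : IsAlmostMetrizable X := by
  obtain ⟨Y, _, _, _, f, hf, U, hU, hfU⟩ := hX
  refine ⟨hf.t2Space, fun x ↦ ?_⟩
  have hUx : ∀ n, U n ∈ 𝓝 (f x) :=
    fun n ↦ (hU n).mem_nhds (mem_iInter.1 (hfU ▸ mem_range_self x) n)
  obtain ⟨W, hWx, hWc, hWU, hWi⟩ := exists_isClosed_seq_subset_interior hUx
  have hrange : ⋂ n, W n ⊆ range f := hfU ▸ iInter_mono hWU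
  have hbasis : (𝓝ˢ (f ⁻¹' ⋂ n, W n)).HasBasis (fun _ ↦ True) fun n ↦ f ⁻¹' W n := by
    rw [hf.isInducing.nhdsSet_eq_comap, image_preimage_eq_of_subset hrange]
    exact (hasBasis_nhdsSet_iInter hWc hWi).comap f
  simp only [subset_interior_iff_mem_nhdsSet]
  exact ⟨f ⁻¹' ⋂ n, W n, mem_iInter.2 fun n ↦ mem_of_mem_nhds (hWx n),
    (hf.isInducing.isCompact_preimage_iff hrange).2 (isClosed_iInter hWc).isCompact,
    fun n ↦ f ⁻¹' W n, fun n ↦ hbasis.mem_of_mem trivial,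
    fun V hV ↦ (hbasis.mem_iff.1 hV).imp fun n hn ↦ hn.2⟩

theorem IsAlmostMetrizable.exists_hasAntitoneBasis {X : Type*} [TopologicalSpace X]
    (hX : IsAlmostMetrizable X) (x : X) :
    ∃ K, x ∈ K ∧ IsCompact K ∧ ∃ B : ℕ → Set X, (𝓝ˢ K).HasAntitoneBasis B := by
  obtain ⟨K, hxK, hK, U, hKU, hU⟩ := hX.2 x
  simp only [subset_interior_iff_mem_nhdsSet] at hKU hU
  have hbasis : (𝓝ˢ K).HasBasis (fun _ ↦ True) U :=
    ⟨fun V ↦ ⟨fun hV ↦ by simpa using hU V hV, fun ⟨n, _, hn⟩ ↦ mem_of_superset (hKU n) hn⟩⟩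
  have : (𝓝ˢ K).IsCountablyGenerated := hbasis.isCountablyGenerated
  exact ⟨K, hxK, hK, (𝓝ˢ K).exists_antitone_basis⟩

theorem isCompact_union_iUnion_of_hasAntitoneBasis {X : Type*} [TopologicalSpace X] {K : Set X}
    (hK : IsCompact K) {B : ℕ → Set X} (hB : (𝓝ˢ K).HasAntitoneBasis B) {A : ℕ → Set X}
    (hA : ∀ n, IsCompact (A n)) (hAB : ∀ n, A n ⊆ B n) : IsCompact (K ∪ ⋃ n, A n) := by
  classical
  refine isCompact_of_finite_subcover fun {ι} U hU hcov ↦ ?_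
  obtain ⟨t, ht⟩ := hK.elim_finite_subcover U hU (subset_union_left.trans hcov)
  obtain ⟨n, hn⟩ := hB.mem_iff.1 ((isOpen_biUnion fun i _ ↦ hU i).mem_nhdsSet.2 ht)
  obtain ⟨s, hs⟩ := ((finite_Iio n).isCompact_biUnion fun m _ ↦ hA m).elim_finite_subcover U hU
    ((iUnion₂_subset fun m _ ↦ subset_iUnion A m).trans (subset_union_right.trans hcov))
  refine ⟨t ∪ s, ?_⟩
  rw [Finset.set_biUnion_union]
  refine union_subset (ht.trans subset_union_left) (iUnion_subset fun m ↦ ?_)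
  rcases lt_or_ge m n with hmn | hnm
  · exact (subset_biUnion_of_mem (u := A) (mem_Iio.2 hmn)).trans (hs.trans subset_union_right)
  · exact ((hAB m).trans (hB.antitone hnm)).trans (hn.trans subset_union_left)

theorem IsAlmostMetrizable.compactlyCoherentSpace {X : Type*} [TopologicalSpace X]
    [RegularSpace X] (hX : IsAlmostMetrizable X) : CompactlyCoherentSpace X := by
  have := hX.1
  refine .of_isClosed fun A hA ↦ isClosed_of_closure_subset fun x hx ↦ ?_
  have hAC : ∀ C, IsCompact C → IsClosed (A ∩ C) := fun C hC ↦
    inter_comm A C ▸ hC.isClosed.inter_preimage_val_iff.1 (hA C hC)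
  by_contra hxA
  obtain ⟨K, hxK, hK, B, hB⟩ := hX.exists_hasAntitoneBasis x
  obtain ⟨W, hW, hWc, hWs⟩ := exists_mem_nhds_isClosed_subset
    ((hAC K hK).isOpen_compl.mem_nhds fun h ↦ hxA h.1)
  choose a ha haA using fun n ↦ mem_closure_iff_nhds.1 hx (W ∩ B n)
    (inter_mem hW (nhds_le_nhdsSet hxK (hB.mem n)))
  have hC : IsCompact (K ∪ ⋃ n, {a n}) := isCompact_union_iUnion_of_hasAntitoneBasis hK hB
    (fun n ↦ isCompact_singleton) fun n ↦ singleton_subset_iff.2 (ha n).2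
  obtain ⟨n, hn⟩ := hB.mem_iff.1 (((hAC _ hC).inter hWc).isOpen_compl.mem_nhdsSet.2
    fun y hy h ↦ hWs h.2 ⟨h.1.1, hy⟩)
  exact hn (ha n).2 ⟨⟨haA n, .inr (mem_iUnion.2 ⟨n, rfl⟩)⟩, (ha n).1⟩

theorem IsKOmegaSpace.of_homeomorph {X Y : Type*} [TopologicalSpace X] [TopologicalSpace Y]
    (hX : IsKOmegaSpace X) (e : X ≃ₜ Y) : IsKOmegaSpace Y := by
  obtain ⟨_, K, hKm, hKc, hKu, hK⟩ := hX
  refine ⟨e.t2Space, fun n ↦ e '' K n, fun m n h ↦ image_mono (hKm h),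
    fun n ↦ (hKc n).image e.continuous, ?_, fun U ↦ ?_⟩
  · rw [← image_iUnion, hKu, image_univ, e.surjective.range_eq]
  · rw [← e.isOpen_preimage, hK]
    exact forall_congr' fun n ↦ (e.image (K n)).isOpen_preimage (s := Subtype.val ⁻¹' U)

theorem IsKOmegaSpace.compactlyCoherentSpace {X : Type*} [TopologicalSpace X]
    (hX : IsKOmegaSpace X) : CompactlyCoherentSpace X := by
  obtain ⟨-, K, -, hKc, -, hK⟩ := hX
  exact .of_isOpen fun U hU ↦ (hK U).2 fun n ↦ hU (K n) (hKc n)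

theorem IsKOmegaSpace.exists_hemicompact {X : Type*} [TopologicalSpace X] (hX : IsKOmegaSpace X) :
    ∃ K : ℕ → Set X, Monotone K ∧ (∀ n, IsCompact (K n)) ∧ ∀ C, IsCompact C → ∃ n, C ⊆ K n := by
  obtain ⟨_, K, hKm, hKc, hKu, hK⟩ := hX
  refine ⟨K, hKm, hKc, fun C hC ↦ ?_⟩
  by_contra! hcon
  choose x hxC hxK using fun n ↦ not_subset.1 (hcon n)
  have hfin : ∀ m k, x '' Ici m ∩ K k ⊆ x '' Iio k := by
    rintro m k _ ⟨⟨n, -, rfl⟩, hn⟩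
    exact ⟨n, not_le.1 fun h ↦ hxK n (hKm h hn), rfl⟩
  have hclosed : ∀ m, IsClosed (x '' Ici m) := fun m ↦ by
    refine isOpen_compl_iff.1 ((hK _).2 fun k ↦ ?_)
    rw [preimage_compl, isOpen_compl_iff, (hKc k).isClosed.inter_preimage_val_iff, inter_comm]
    exact (((finite_Iio k).image x).subset (hfin m k)).isClosed
  obtain ⟨z, hz⟩ := IsCompact.nonempty_iInter_of_sequence_nonempty_isCompact_isClosed
    (fun m ↦ x '' Ici m) (fun m ↦ image_mono (Ici_subset_Ici.2 m.le_succ))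
    (fun m ↦ ⟨x m, m, self_mem_Ici, rfl⟩)
    (hC.of_isClosed_subset (hclosed 0) (image_subset_iff.2 fun n _ ↦ hxC n)) hclosed
  obtain ⟨k, hk⟩ := mem_iUnion.1 (hKu ▸ mem_univ z)
  obtain ⟨n, hn, rfl⟩ := mem_iInter.1 hz k
  exact hxK n (hKm hn hk)

theorem compactlyCoherentSpace_of_isOpen_nhds {X : Type*} [TopologicalSpace X]
    (h : ∀ x : X, ∃ U : Set X, IsOpen U ∧ x ∈ U ∧ CompactlyCoherentSpace U) :
    CompactlyCoherentSpace X := by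
  refine .of_isOpen fun A hA ↦ isOpen_iff_mem_nhds.2 fun x hx ↦ ?_
  obtain ⟨U, hU, hxU, _⟩ := h x
  have hAU : IsOpen ((↑) ⁻¹' A : Set U) := CompactlyCoherentSpace.isCoherentWith.isOpen_iff.2
    fun C hC ↦ (hA _ (hC.image continuous_subtype_val)).preimage
      (continuous_subtype_val.subtype_map fun c hc ↦ mem_image_of_mem _ hc)
  exact mem_of_superset ((hU.isOpenMap_subtype_val _ hAU).mem_nhds ⟨⟨x, hxU⟩, hx, rfl⟩)
    (image_preimage_subset _ _)

theorem IsLocallyKOmegaSpace.compactlyCoherentSpace {X : Type*} [TopologicalSpace X]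
    (hX : IsLocallyKOmegaSpace X) : CompactlyCoherentSpace X :=
  compactlyCoherentSpace_of_isOpen_nhds fun x ↦ (hX.2 x).imp fun _ hU ↦
    ⟨hU.1, hU.2.1, hU.2.2.compactlyCoherentSpace⟩

theorem IsLocallyKOmegaSpace.exists_nhds_hemicompact {X : Type*} [TopologicalSpace X]
    (hX : IsLocallyKOmegaSpace X) (x : X) :
    ∃ U ∈ 𝓝 x, ∃ K : ℕ → Set X, Monotone K ∧ (∀ n, IsCompact (K n)) ∧
      ∀ C ⊆ U, IsCompact C → ∃ n, C ⊆ K n := by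
  obtain ⟨U, hU, hxU, hkU⟩ := hX.2 x
  obtain ⟨K, hKm, hKc, hK⟩ := hkU.exists_hemicompact
  refine ⟨U, hU.mem_nhds hxU, fun n ↦ (↑) '' K n, fun m n h ↦ image_mono (hKm h),
    fun n ↦ (hKc n).image continuous_subtype_val, fun C hCU hC ↦ ?_⟩
  have hrange : C ⊆ range ((↑) : U → X) := Subtype.range_coe.symm ▸ hCU
  obtain ⟨n, hn⟩ := hK _ ((IsInducing.subtypeVal.isCompact_preimage_iff hrange).2 hC)
  exact ⟨n, image_preimage_eq_of_subset hrange ▸ image_mono hn⟩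

theorem isKOmegaSpace_of_isCompact_seq {X : Type*} [TopologicalSpace X] [T2Space X] {V : Set X}
    {P : ℕ → Set X} (hPm : Monotone P) (hPc : ∀ n, IsCompact (P n)) (hPV : ⋃ n, P n = V)
    (h : ∀ Z : Set X, (∀ n, IsClosed (Z ∩ P n)) → ∀ x ∈ V \ Z, Zᶜ ∈ 𝓝[V] x) :
    IsKOmegaSpace V := by
  have hrange : ∀ n, P n ⊆ range ((↑) : V → X) :=
    fun n ↦ Subtype.range_coe.symm ▸ hPV ▸ subset_iUnion P n
  have hPVc : ∀ n, IsCompact ((↑) ⁻¹' P n : Set V) :=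
    fun n ↦ (IsInducing.subtypeVal.isCompact_preimage_iff (hrange n)).2 (hPc n)
  refine ⟨inferInstance, fun n ↦ (↑) ⁻¹' P n, fun m n hmn ↦ preimage_mono (hPm hmn), hPVc, ?_,
    fun U ↦ ⟨fun hU n ↦ hU.preimage continuous_subtype_val, fun hU ↦ ?_⟩⟩
  · rw [← preimage_iUnion, hPV, Subtype.coe_preimage_self]
  · have hZ : ∀ n, IsClosed ((↑) '' Uᶜ ∩ P n) := fun n ↦ by
      have hUc : IsClosed ((↑) ⁻¹' P n ∩ Uᶜ : Set V) :=
        (hPVc n).isClosed.inter_preimage_val_iff.1 (hU n).isClosed_compl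
      rw [← image_inter_preimage, inter_comm]
      exact (((hPVc n).of_isClosed_subset hUc inter_subset_left).image
        continuous_subtype_val).isClosed
    refine isOpen_iff_mem_nhds.2 fun x hx ↦ mem_of_superset
      (preimage_coe_mem_nhds_subtype.2 (h _ hZ x ⟨x.2, ?_⟩)) fun y hy ↦ ?_
    · simpa using hx
    · simpa using hy

theorem isLocallyKOmegaSpace_of_isOpen_nhds_one {H : Type*} [Group H] [TopologicalSpace H]
    [ContinuousMul H] [T2Space H] {V : Set H} (hV : IsOpen V) (h1 : 1 ∈ V)
    (hkV : IsKOmegaSpace V) : IsLocallyKOmegaSpace H :=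
  ⟨inferInstance, fun x ↦ ⟨Homeomorph.mulLeft x '' V, (Homeomorph.mulLeft x).isOpenMap _ hV,
    ⟨1, h1, mul_one x⟩, hkV.of_homeomorph ((Homeomorph.mulLeft x).image V)⟩⟩

section UniformOnCompacts

variable {F X Y : Type*} [FunLike F X Y] [PseudoMetricSpace Y]

/-- The closed uniform ball of radius `ε` around `f₀` on `S`: the functions whose values on `S`
differ from those of `f₀` by at most `ε`. For compact `S` and `ε > 0` these sets form a basis of
neighbourhoods of `f₀` in the compact-open topology. -/
def closedBallOn (f₀ : F) (S : Set X) (ε : ℝ) : Set F :=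
  {f | ∀ x ∈ S, dist (f x) (f₀ x) ≤ ε}

theorem isClosed_closedBallOn [TopologicalSpace F] [ContinuousEvalConst F X Y]
    (f₀ : F) (S : Set X) (ε : ℝ) : IsClosed (closedBallOn f₀ S ε) := by
  simp only [closedBallOn, ofPred_forall]
  exact isClosed_biInter fun x _ ↦
    isClosed_le ((continuous_eval_const x).dist continuous_const) continuous_const

theorem uniformCauchySeqOn_of_closedBallOn_mem {l : Filter F} {S : Set X}
    (h : ∀ ε > 0, ∃ f₀ : F, closedBallOn f₀ S ε ∈ l) :
    UniformCauchySeqOn (fun f : F ↦ ⇑f) l S := by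
  intro u hu
  obtain ⟨ε, hε, hεu⟩ := Metric.uniformity_basis_dist_le.mem_iff.1 hu
  obtain ⟨f₀, hf₀⟩ := h (ε / 2) (half_pos hε)
  filter_upwards [prod_mem_prod hf₀ hf₀] with p hp x hx
  have hpx : dist (p.1 x) (p.2 x) ≤ ε := by
    linarith [dist_triangle_right (p.1 x) (p.2 x) (f₀ x), hp.1 x hx, hp.2 x hx]
  exact hεu hpx

end UniformOnCompacts

theorem uniformCauchySeqOn_of_nhds_one {F G E : Type*} [Group G] [TopologicalSpace G]
    [IsTopologicalGroup G] [Group E] [UniformSpace E] [IsUniformGroup E] [FunLike F G E]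
    [MonoidHomClass F G E] {l : Filter F} {U : Set G} (hU : U ∈ 𝓝 1)
    (hl : ∀ g : G, Cauchy (map (fun χ : F ↦ χ g) l))
    (hlU : ∀ C ⊆ U, IsCompact C → UniformCauchySeqOn (fun χ : F ↦ ⇑χ) l C)
    {K : Set G} (hK : IsCompact K) : UniformCauchySeqOn (fun χ : F ↦ ⇑χ) l K := by
  obtain ⟨W, hW, hWc, hWU⟩ := exists_mem_nhds_isClosed_subset hU
  suffices hloc : ∀ g ∈ K, ∃ t ∈ 𝓝[K] g, UniformCauchySeqOn (fun χ : F ↦ ⇑χ) l t from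
    hK.induction_on (fun u _ ↦ .of_forall fun _ _ ↦ False.elim) (fun _ _ hst ht ↦ ht.mono hst)
      (fun s t hs ht u hu ↦ by
        filter_upwards [hs u hu, ht u hu] with p hps hpt x hx using hx.elim (hps x) (hpt x)) hloc
  intro g _
  have hgW : (g⁻¹ * ·) ⁻¹' W ∈ 𝓝 g :=
    (continuous_const_mul g⁻¹).continuousAt.preimage_mem_nhds (by simpa using hW)
  refine ⟨K ∩ (g⁻¹ * ·) ⁻¹' W, inter_mem_nhdsWithin K hgW, ?_⟩
  have hconst : UniformCauchySeqOn (fun (χ : F) (_ : G) ↦ χ g) l (K ∩ (g⁻¹ * ·) ⁻¹' W) :=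
    fun u hu ↦ mem_of_superset ((cauchy_map_iff.1 (hl g)).2 hu) fun p hp _ _ ↦ hp
  have htranslate : UniformCauchySeqOn (fun (χ : F) (x : G) ↦ χ (g⁻¹ * x)) l
      (K ∩ (g⁻¹ * ·) ⁻¹' W) :=
    ((hlU (((g⁻¹ * ·) '' K) ∩ W) (inter_subset_right.trans hWU)
      ((hK.image (continuous_const_mul g⁻¹)).inter_right hWc)).comp (g⁻¹ * ·)).mono
        fun x hx ↦ ⟨mem_image_of_mem _ hx.1, hx.2⟩
  convert hconst.mul htranslate with χ
  ext x
  rw [Pi.mul_apply, Pi.mul_apply, ← map_mul, mul_inv_cancel_left]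

theorem isCompleteTopGroup_of_isClosedEmbedding {H E : Type*} [Group H] [TopologicalSpace H]
    [IsTopologicalGroup H] [Group E] [UniformSpace E] [IsUniformGroup E] [CompleteSpace E]
    (f : H →* E) (hf : IsClosedEmbedding f) : IsCompleteTopGroup H := by
  let := IsTopologicalGroup.leftUniformSpace H
  have hfu : IsUniformInducing f := ⟨by
    rw [uniformity_eq_comap_inv_mul_nhds_one, comap_comap]
    change _ = comap (fun p : H × H ↦ p.1⁻¹ * p.2) (𝓝 1)
    rw [hf.isInducing.nhds_eq_comap, comap_comap, map_one]
    congr 1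
    ext p
    simp⟩
  exact (completeSpace_iff_isComplete_range hfu).2 hf.isClosed_range.isComplete

instance {X E : Type*} [TopologicalSpace X] [Group E] [UniformSpace E] [IsUniformGroup E] :
    IsUniformGroup C(X, E) :=
  let toUniformOnFun : C(X, E) →* X →ᵤ[{K | IsCompact K}] E :=
    { toFun := ContinuousMap.toUniformOnFunIsCompact, map_one' := rfl, map_mul' := fun _ _ ↦ rfl }
  IsUniformInducing.isUniformGroup toUniformOnFun
    ContinuousMap.isUniformEmbedding_toUniformOnFunIsCompact.isUniformInducing

section ContinuousMonoidHom

variable {G E : Type*} [Monoid G] [TopologicalSpace G]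

instance [Monoid E] [UniformSpace E] [T2Space E] : T35Space (G →ₜ* E) where
  toCompletelyRegularSpace :=
    (ContinuousMonoidHom.isInducing_toContinuousMap G E).completelyRegularSpace

theorem hasBasis_nhds_closedBallOn [Monoid E] [PseudoMetricSpace E] (χ : G →ₜ* E) :
    (𝓝 χ).HasBasis (fun p : Set G × ℝ ↦ IsCompact p.1 ∧ 0 < p.2)
      fun p ↦ closedBallOn χ p.1 p.2 := by
  rw [(ContinuousMonoidHom.isInducing_toContinuousMap G E).nhds_eq_comap]
  exact (nhds_basis_uniformity
    Metric.uniformity_basis_dist_le.compactConvergenceUniformity).comap _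

theorem isCompleteTopGroup_continuousMonoidHom [CompactlyCoherentSpace G] [CommGroup E]
    [UniformSpace E] [IsUniformGroup E] [T2Space E] [CompleteSpace E] :
    IsCompleteTopGroup (G →ₜ* E) :=
  isCompleteTopGroup_of_isClosedEmbedding
    { toFun := ContinuousMonoidHom.toContinuousMap, map_one' := rfl, map_mul' := fun _ _ ↦ rfl }
    (ContinuousMonoidHom.isClosedEmbedding_toContinuousMap G E)

theorem exists_le_nhds_of_uniformCauchySeqOn [CompactlyCoherentSpace G] [Monoid E]
    [UniformSpace E] [ContinuousMul E] [T2Space E] [CompleteSpace E] {l : Filter (G →ₜ* E)}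
    [NeBot l]
    (hl : ∀ K, IsCompact K → UniformCauchySeqOn (fun χ : G →ₜ* E ↦ ⇑χ) l K) :
    ∃ χ, l ≤ 𝓝 χ := by
  have hemb := ContinuousMonoidHom.isClosedEmbedding_toContinuousMap G E
  have hcauchy : Cauchy (map ContinuousMonoidHom.toContinuousMap l) :=
    cauchy_map_iff.2 ⟨‹_›, ContinuousMap.hasBasis_compactConvergenceUniformity.tendsto_right_iff.2
      fun ⟨K, u⟩ ⟨hK, hu⟩ ↦ hl K hK u hu⟩
  obtain ⟨f, hf⟩ := CompleteSpace.complete hcauchy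
  obtain ⟨χ, rfl⟩ := hemb.isClosed_range.mem_of_tendsto hf (.of_forall mem_range_self)
  exact ⟨χ, hemb.isInducing.tendsto_nhds_iff.2 hf⟩

end ContinuousMonoidHom

theorem IsLocallyKOmegaSpace.isCechComplete_continuousMonoidHom {G E : Type*} [Group G]
    [TopologicalSpace G] [IsTopologicalGroup G] [Group E] [MetricSpace E] [IsTopologicalGroup E]
    [CompactSpace E] (hG : IsLocallyKOmegaSpace G) :
    IsCechComplete (G →ₜ* E) := by
  have := hG.compactlyCoherentSpace
  obtain ⟨U, hU, K, hKm, hKc, hK⟩ := hG.exists_nhds_hemicompact 1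
  refine isCechComplete_of_ultrafilter (fun n χ ↦ closedBallOn χ (K n) (1 / ((n : ℝ) + 1)))
    (fun n χ ↦ (hasBasis_nhds_closedBallOn χ).mem_of_mem (i := (K n, _))
      ⟨hKc n, Nat.one_div_pos_of_nat⟩) fun F hF ↦ ?_
  have hFK : ∀ n, UniformCauchySeqOn (fun χ : G →ₜ* E ↦ ⇑χ) F (K n) := fun n ↦ by
    refine uniformCauchySeqOn_of_closedBallOn_mem fun ε hε ↦ ?_
    obtain ⟨N, hN⟩ := exists_nat_one_div_lt hε
    obtain ⟨χ, hχ⟩ := hF (max n N)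
    refine ⟨χ, mem_of_superset hχ fun ψ hψ x hx ↦ (hψ x (hKm (le_max_left n N) hx)).trans ?_⟩
    exact (Nat.one_div_le_one_div (le_max_right n N)).trans hN.le
  have hcauchy : ∀ g : G, Cauchy (map (fun χ : G →ₜ* E ↦ χ g) F) :=
    fun g ↦ cauchy_nhds.mono (F.map fun χ : G →ₜ* E ↦ χ g).le_nhds_lim
  refine exists_le_nhds_of_uniformCauchySeqOn fun C hC ↦
    uniformCauchySeqOn_of_nhds_one hU hcauchy (fun D hDU hD ↦ ?_) hC
  obtain ⟨n, hn⟩ := hK D hDU hD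
  exact (hFK n).mono hn

theorem isCompact_preimage_toMonoidHom {G E : Type*} [Monoid G] [TopologicalSpace G] [Monoid E]
    [UniformSpace E] [CompactSpace E] {S : Set (G →* E)}
    (hS : IsClosed ((fun χ : G →* E ↦ ⇑χ) '' S)) (hSe : Equicontinuous fun χ : S ↦ ⇑χ.1) :
    IsCompact {χ : G →ₜ* E | (χ : G →* E) ∈ S} := by
  let T : Set C(G, E) := ContinuousMonoidHom.toContinuousMap '' {χ : G →ₜ* E | (χ : G →* E) ∈ S}
  have hT : ContinuousMap.toFun '' T = (fun χ : G →* E ↦ ⇑χ) '' S := by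
    ext f
    constructor
    · rintro ⟨_, ⟨χ, hχ, rfl⟩, rfl⟩
      exact ⟨χ, hχ, rfl⟩
    · rintro ⟨χ, hχ, rfl⟩
      exact ⟨_, ⟨⟨χ, hSe.continuous ⟨χ, hχ⟩⟩, hχ, rfl⟩, rfl⟩
  refine (ContinuousMonoidHom.isInducing_toContinuousMap G E).isCompact_iff.2
    (ArzelaAscoli.isCompact_of_equicontinuous T (hT ▸ hS.isCompact) ?_)
  have hTS : ∀ f : T, ∃ χ : S, ⇑χ.1 = f.1 := by
    rintro ⟨_, χ, hχ, rfl⟩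
    exact ⟨⟨χ, hχ⟩, rfl⟩
  choose u hu using hTS
  exact (funext hu : (fun f ↦ ⇑(u f).1) = fun f : T ↦ ⇑f.1) ▸ hSe.comp u

section Circle

theorem circle_re_sq_add_im_sq (z : Circle) : (z : ℂ).re ^ 2 + (z : ℂ).im ^ 2 = 1 := by
  rw [← z.normSq_coe, Complex.normSq_apply]
  ring

theorem circle_dist_one_sq (z : Circle) : dist z 1 ^ 2 = 2 * (1 - (z : ℂ).re) := by
  change dist (z : ℂ) 1 ^ 2 = _
  rw [dist_eq_norm, Complex.sq_norm, Complex.normSq_apply, Complex.sub_re, Complex.sub_im,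
    Complex.one_re, Complex.one_im]
  linarith [circle_re_sq_add_im_sq z]

theorem circle_re_sub_re_le_dist (z w : Circle) : (z : ℂ).re - (w : ℂ).re ≤ dist z w :=
  (Complex.re_le_norm ((z : ℂ) - w)).trans_eq (dist_eq_norm (z : ℂ) w).symm

theorem continuous_circle_re : Continuous fun z : Circle ↦ (z : ℂ).re :=
  Complex.continuous_re.comp continuous_subtype_val

theorem two_mul_one_sub_circle_re_le {z : Circle} (hz : 0 ≤ (z : ℂ).re) :
    2 * (1 - (z : ℂ).re) ≤ 1 - ((z ^ 2 : Circle) : ℂ).re := by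
  have hre : ((z ^ 2 : Circle) : ℂ).re = (z : ℂ).re ^ 2 - (z : ℂ).im ^ 2 := by
    rw [Circle.coe_pow, sq, Complex.mul_re, sq, sq]
  nlinarith [circle_re_sq_add_im_sq z, sq_nonneg (z : ℂ).im]

theorem one_sub_circle_re_le_of_pow (k : ℕ) (z : Circle)
    (h : ∀ j ≤ k, 0 ≤ ((z ^ 2 ^ j : Circle) : ℂ).re) : 1 - (z : ℂ).re ≤ (1 / 2) ^ k := by
  induction k generalizing z with
  | zero => simpa using h 0 le_rfl
  | succ k ih =>
    have hz : 0 ≤ (z : ℂ).re := by simpa using h 0 k.succ.zero_le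
    have hsq : 1 - ((z ^ 2 : Circle) : ℂ).re ≤ (1 / 2) ^ k := ih (z ^ 2) fun j hj ↦ by
      rw [← pow_mul, ← pow_succ']
      exact h (j + 1) (Nat.succ_le_succ hj)
    rw [pow_succ]
    linarith [two_mul_one_sub_circle_re_le hz]

end Circle

theorem equicontinuous_of_re_nonneg {G : Type*} [Group G] [TopologicalSpace G]
    [IsTopologicalGroup G] {U : Set G} (hU : U ∈ 𝓝 1) :
    Equicontinuous fun χ : {χ : G →* Circle | ∀ x ∈ U, 0 ≤ (χ x : ℂ).re} ↦ ⇑χ.1 := by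
  refine equicontinuous_of_equicontinuousAt_one
    (fun χ : {χ : G →* Circle | ∀ x ∈ U, 0 ≤ (χ x : ℂ).re} ↦ χ.1)
    (Metric.equicontinuousAt_iff_right.2 fun ε hε ↦ ?_)
  obtain ⟨k, hk⟩ := exists_pow_lt_of_lt_one (half_pos (pow_pos hε 2)) (one_half_lt_one (α := ℝ))
  have hpow : ∀ᶠ x : G in 𝓝 1, ∀ j ∈ Iic k, x ^ 2 ^ j ∈ U :=
    (finite_Iic k).eventually_all.2 fun j _ ↦
      (continuous_pow (2 ^ j)).continuousAt.preimage_mem_nhds (by simpa using hU)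
  filter_upwards [hpow] with x hx χ
  have hre : 1 - (χ.1 x : ℂ).re ≤ (1 / 2) ^ k := one_sub_circle_re_le_of_pow k _ fun j hj ↦ by
    rw [← map_pow]
    exact χ.2 _ (hx j hj)
  refine lt_of_pow_lt_pow_left₀ 2 hε.le ?_
  rw [Function.comp_apply, map_one, dist_comm, circle_dist_one_sq]
  linarith

section Polar

variable {G : Type*} [Monoid G] [TopologicalSpace G]

/-- The characters which map `S` into the half-plane `c ≤ re z`. With `c = 0` this is a common
version of the polar of `S` in duality theory; the bounds `c > 0` serve to exhaust `positiveOn`. -/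
def polar (S : Set G) (c : ℝ) : Set (G →ₜ* Circle) :=
  {χ | ∀ x ∈ S, c ≤ (χ x : ℂ).re}

/-- The characters which map `S` into the open right half-plane. For compact `S` they form an
open neighbourhood of the trivial character. -/
def positiveOn (S : Set G) : Set (G →ₜ* Circle) :=
  {χ | ∀ x ∈ S, 0 < (χ x : ℂ).re}

theorem polar_subset_polar {S T : Set G} {c d : ℝ} (hTS : T ⊆ S) (hdc : d ≤ c) :
    polar S c ⊆ polar T d :=
  fun _ hχ x hx ↦ hdc.trans (hχ x (hTS hx))

theorem monotone_polar {B : ℕ → Set G} (hB : Antitone B) :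
    Monotone fun n ↦ polar (B n) ((1 / 2) ^ n) :=
  fun _ _ hmn ↦ polar_subset_polar (hB hmn)
    (pow_le_pow_of_le_one one_half_pos.le one_half_lt_one.le hmn)

theorem closedBallOn_subset_polar {S : Set G} {c d ε : ℝ} {χ : G →ₜ* Circle}
    (hχ : χ ∈ polar S c) (hdc : d + ε ≤ c) : closedBallOn χ S ε ⊆ polar S d := by
  intro ψ hψ x hx
  have hdist : (χ x : ℂ).re - (ψ x : ℂ).re ≤ ε :=
    (circle_re_sub_re_le_dist _ _).trans (dist_comm (χ x) (ψ x) ▸ hψ x hx)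
  linarith [hχ x hx]

theorem closedBallOn_subset_polar_of_lt {B : ℕ → Set G} (hB : Antitone B) {m n : ℕ} {ε : ℝ}
    {χ : G →ₜ* Circle} (hχ : χ ∈ polar (B m) ((1 / 2) ^ m)) (hmn : m < n)
    (hε : ε ≤ (1 / 2) ^ (m + 1)) : closedBallOn χ (B n) ε ⊆ polar (B n) ((1 / 2) ^ n) := by
  refine closedBallOn_subset_polar (polar_subset_polar (hB hmn.le) le_rfl hχ) ?_
  have hpow : (1 / 2 : ℝ) ^ n ≤ (1 / 2) ^ (m + 1) :=
    pow_le_pow_of_le_one one_half_pos.le one_half_lt_one.le hmn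
  linarith [pow_succ (1 / 2 : ℝ) m]

theorem isOpen_positiveOn {K : Set G} (hK : IsCompact K) : IsOpen (positiveOn K) :=
  (ContinuousMap.isOpen_setOfPred_mapsTo hK
    (isOpen_lt continuous_const continuous_circle_re)).preimage
      (ContinuousMonoidHom.isInducing_toContinuousMap G Circle).continuous

theorem iUnion_polar_eq_positiveOn {K : Set G} (hK : IsCompact K) {B : ℕ → Set G}
    (hB : (𝓝ˢ K).HasAntitoneBasis B) : ⋃ n, polar (B n) ((1 / 2) ^ n) = positiveOn K := by
  refine Subset.antisymm (iUnion_subset fun n χ hχ x hx ↦ ?_) fun χ hχ ↦ mem_iUnion.2 ?_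
  · exact (pow_pos one_half_pos n).trans_le (hχ x (subset_of_mem_nhdsSet (hB.mem n) hx))
  let V : ℕ → Set G := fun k ↦ {x | (1 / 2) ^ k < (χ x : ℂ).re}
  have hV : ∀ k, IsOpen (V k) := fun k ↦
    isOpen_lt continuous_const (continuous_circle_re.comp (map_continuous χ))
  have hVmono : Monotone V := fun k l hkl x (hx : (1 / 2) ^ k < (χ x : ℂ).re) ↦
    (pow_le_pow_of_le_one one_half_pos.le one_half_lt_one.le hkl).trans_lt hx
  obtain ⟨k, hk⟩ := hK.elim_directed_cover V hV
    (fun x hx ↦ mem_iUnion.2 (exists_pow_lt_of_lt_one (hχ x hx) one_half_lt_one))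
    hVmono.directed_le
  obtain ⟨n, hn⟩ := hB.mem_iff.1 ((hV k).mem_nhdsSet.2 hk)
  exact ⟨max k n, fun x hx ↦ (hVmono (le_max_left k n)
    (hn (hB.antitone (le_max_right k n) hx))).le⟩

end Polar

section BanachDieudonne

variable {F X Y : Type*} [FunLike F X Y] [PseudoMetricSpace Y]

theorem closedBallOn_anti (f₀ : F) {S T : Set X} (hST : S ⊆ T) (ε : ℝ) :
    closedBallOn f₀ T ε ⊆ closedBallOn f₀ S ε :=
  fun _ hf x hx ↦ hf x (hST hx)

theorem closedBallOn_union (f₀ : F) (S T : Set X) (ε : ℝ) :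
    closedBallOn f₀ (S ∪ T) ε = closedBallOn f₀ S ε ∩ closedBallOn f₀ T ε :=
  Set.ext fun _ ↦ forall₂_or_left

variable [TopologicalSpace F] [ContinuousEvalConst F X Y]

theorem exists_finite_disjoint_closedBallOn {f₀ : F} {Z : Set F} {S T : Set X} {ε : ℝ}
    (hZ : IsCompact Z) (h : Disjoint Z (closedBallOn f₀ (S ∪ T) ε)) :
    ∃ A ⊆ T, A.Finite ∧ Disjoint Z (closedBallOn f₀ (S ∪ A) ε) := by
  have hcover : Z ∩ closedBallOn f₀ S ε ⊆ ⋃ x ∈ T, {f | ε < dist (f x) (f₀ x)} := by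
    rintro f ⟨hfZ, hfS⟩
    by_contra hfT
    simp only [mem_iUnion, mem_ofPred_eq, not_exists, not_lt] at hfT
    exact h.notMem_of_mem_left hfZ (closedBallOn_union f₀ S T ε ▸ ⟨hfS, hfT⟩)
  obtain ⟨A, hAT, hAf, hA⟩ := (hZ.inter_right
    (isClosed_closedBallOn f₀ S ε)).elim_finite_subcover_image (fun x _ ↦
      isOpen_lt continuous_const ((continuous_eval_const x).dist continuous_const)) hcover
  refine ⟨A, hAT, hAf, disjoint_left.2 fun f hfZ hf ↦ ?_⟩
  rw [closedBallOn_union] at hf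
  obtain ⟨x, hxA, hx⟩ := mem_iUnion₂.1 (hA ⟨hfZ, hf.1⟩)
  exact (hf.2 x hxA).not_gt hx

theorem exists_finite_seq_disjoint_closedBallOn {f₀ : F} {Z : Set F} {P : ℕ → Set F}
    {B : ℕ → Set X} {C : Set X} {ε : ℝ} (hZ : ∀ n, IsCompact (Z ∩ P n))
    (hBP : ∀ n, closedBallOn f₀ (B n) ε ⊆ P n) (hC : Disjoint (Z ∩ P 0) (closedBallOn f₀ C ε)) :
    ∃ A : ℕ → Set X, (∀ n, A n ⊆ B n) ∧ (∀ n, (A n).Finite) ∧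
      Disjoint (Z ∩ ⋃ n, P n) (closedBallOn f₀ (C ∪ ⋃ n, A n) ε) := by
  have hstep : ∀ n D, Disjoint (Z ∩ P n) (closedBallOn f₀ D ε) → ∃ A ⊆ B n, A.Finite ∧
      Disjoint (Z ∩ P (n + 1)) (closedBallOn f₀ (D ∪ A) ε) := fun n D hD ↦ by
    -- A function of the ball on `D ∪ B n` lies in `P n`, where `D` alone already excludes it.
    refine exists_finite_disjoint_closedBallOn (hZ (n + 1)) (disjoint_left.2 fun f hfZ hf ↦ ?_)
    rw [closedBallOn_union] at hf
    exact hD.notMem_of_mem_left ⟨hfZ.1, hBP n hf.2⟩ hf.1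
  choose! A hAB hAf hA using hstep
  let D : ℕ → Set X := fun n ↦ n.rec C fun k D ↦ D ∪ A k D
  have hD : ∀ n, Disjoint (Z ∩ P n) (closedBallOn f₀ (D n) ε) := fun n ↦ by
    induction n with
    | zero => exact hC
    | succ k ih => exact hA k (D k) ih
  have hDA : ∀ n, D n ⊆ C ∪ ⋃ k, A k (D k) := fun n ↦ by
    induction n with
    | zero => exact subset_union_left
    | succ k ih =>
      exact union_subset ih ((subset_iUnion (fun k ↦ A k (D k)) k).trans subset_union_right)
  refine ⟨fun n ↦ A n (D n), fun n ↦ hAB n _ (hD n), fun n ↦ hAf n _ (hD n), ?_⟩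
  rw [inter_iUnion, disjoint_iUnion_left]
  exact fun n ↦ (hD n).mono_right (closedBallOn_anti f₀ (hDA n) ε)

end BanachDieudonne

section AlmostMetrizable

variable {G : Type*} [Group G] [TopologicalSpace G] [IsTopologicalGroup G] {K : Set G}
  {B : ℕ → Set G}

theorem isCompact_polar {U : Set G} (hU : U ∈ 𝓝 1) {c : ℝ} (hc : 0 ≤ c) :
    IsCompact (polar U c) := by
  let S : Set (G →* Circle) := {χ | ∀ x ∈ U, c ≤ (χ x : ℂ).re}
  have hS : (fun χ : G →* Circle ↦ ⇑χ) '' S =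
      {f | ∀ x ∈ U, c ≤ (f x : ℂ).re} ∩ range fun χ : G →* Circle ↦ ⇑χ :=
    image_preimage_eq_inter_range (f := fun χ : G →* Circle ↦ ⇑χ)
      (t := {f | ∀ x ∈ U, c ≤ (f x : ℂ).re})
  have hclosed : IsClosed {f : G → Circle | ∀ x ∈ U, c ≤ (f x : ℂ).re} := by
    simp only [ofPred_forall]
    exact isClosed_biInter fun x _ ↦
      isClosed_le continuous_const (continuous_circle_re.comp (continuous_apply x))
  refine isCompact_preimage_toMonoidHom (S := S)
    (hS ▸ hclosed.inter (MonoidHom.isClosed_range_coe G Circle)) ?_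
  exact (equicontinuous_of_re_nonneg hU).comp (inclusion
    fun χ (hχ : ∀ x ∈ U, c ≤ (χ x : ℂ).re) x hx ↦ hc.trans (hχ x hx))

theorem compl_mem_nhdsWithin_positiveOn (h1 : 1 ∈ K) (hK : IsCompact K)
    (hB : (𝓝ˢ K).HasAntitoneBasis B) {Z : Set (G →ₜ* Circle)}
    (hZ : ∀ n, IsClosed (Z ∩ polar (B n) ((1 / 2) ^ n))) {χ₀ : G →ₜ* Circle}
    (hχ₀ : χ₀ ∈ positiveOn K \ Z) : Zᶜ ∈ 𝓝[positiveOn K] χ₀ := by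
  let P : ℕ → Set (G →ₜ* Circle) := fun n ↦ polar (B n) ((1 / 2) ^ n)
  have hP : Monotone P := monotone_polar hB.antitone
  obtain ⟨N, hN⟩ := mem_iUnion.1 (iUnion_polar_eq_positiveOn hK hB ▸ hχ₀.1)
  have hPN : ⋃ n, P (n + (N + 1)) = positiveOn K :=
    (hP.iUnion_nat_add (N + 1)).trans (iUnion_polar_eq_positiveOn hK hB)
  have hZc : ∀ n, IsCompact (Z ∩ P n) := fun n ↦
    (isCompact_polar (nhds_le_nhdsSet h1 (hB.mem n)) (by positivity)).of_isClosed_subset (hZ n)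
      inter_subset_right
  obtain ⟨⟨C, ε₀⟩, ⟨hC, hε₀⟩, hCZ⟩ := (hasBasis_nhds_closedBallOn χ₀).mem_iff.1
    ((hZ (N + 1)).isOpen_compl.mem_nhds fun h ↦ hχ₀.2 h.1)
  let ε : ℝ := min ε₀ ((1 / 2) ^ (N + 1))
  have hε : 0 < ε := lt_min hε₀ (by positivity)
  have hBP : ∀ n, closedBallOn χ₀ (B (n + (N + 1))) ε ⊆ P (n + (N + 1)) :=
    fun n ↦ closedBallOn_subset_polar_of_lt hB.antitone hN (by lia) (min_le_right _ _)
  have hCε : Disjoint (Z ∩ P (0 + (N + 1))) (closedBallOn χ₀ C ε) := by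
    rw [zero_add]
    exact disjoint_left.2 fun χ hχZ hχ ↦
      hCZ (fun x hx ↦ (hχ x hx).trans (min_le_left _ _)) hχZ
  obtain ⟨A, hAB, hAf, hA⟩ := exists_finite_seq_disjoint_closedBallOn
    (fun n ↦ hZc (n + (N + 1))) hBP hCε
  rw [hPN] at hA
  have hKA : IsCompact (K ∪ ⋃ n, A n) := isCompact_union_iUnion_of_hasAntitoneBasis hK hB
    (fun n ↦ (hAf n).isCompact) fun n ↦ (hAB n).trans (hB.antitone (by lia))
  have hball : closedBallOn χ₀ (C ∪ (K ∪ ⋃ n, A n)) ε ∈ 𝓝 χ₀ :=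
    (hasBasis_nhds_closedBallOn χ₀).mem_of_mem (i := (_, ε)) ⟨hC.union hKA, hε⟩
  refine mem_nhdsWithin_iff_exists_mem_nhds_inter.2 ⟨_, hball, fun χ hχ hχZ ↦ ?_⟩
  exact hA.notMem_of_mem_left ⟨hχZ, hχ.2⟩
    (closedBallOn_anti χ₀ (union_subset_union_right C subset_union_right) ε hχ.1)

theorem isKOmegaSpace_positiveOn (h1 : 1 ∈ K) (hK : IsCompact K)
    (hB : (𝓝ˢ K).HasAntitoneBasis B) : IsKOmegaSpace (positiveOn K) :=
  isKOmegaSpace_of_isCompact_seq (monotone_polar hB.antitone)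
    (fun n ↦ isCompact_polar (nhds_le_nhdsSet h1 (hB.mem n)) (by positivity))
    (iUnion_polar_eq_positiveOn hK hB)
    fun _ hZ _ hχ ↦ compl_mem_nhdsWithin_positiveOn h1 hK hB hZ hχ

theorem IsAlmostMetrizable.isLocallyKOmegaSpace_continuousMonoidHom (hG : IsAlmostMetrizable G) :
    IsLocallyKOmegaSpace (G →ₜ* Circle) := by
  obtain ⟨K, h1, hK, B, hB⟩ := hG.exists_hasAntitoneBasis 1
  exact isLocallyKOmegaSpace_of_isOpen_nhds_one (isOpen_positiveOn hK) (fun x _ ↦ by simp)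
    (isKOmegaSpace_positiveOn h1 hK hB)

end AlmostMetrizable

theorem mainTheorem5_general (G : Type*) [Group G] [TopologicalSpace G] [IsTopologicalGroup G] :
    (IsLocallyKOmegaSpace G →
      IsCechComplete (PontryaginDual G) ∧ IsAlmostMetrizable (PontryaginDual G) ∧
        IsCompleteTopGroup (PontryaginDual G)) ∧
    (IsAlmostMetrizable G →
      IsLocallyKOmegaSpace (PontryaginDual G) ∧ IsCompleteTopGroup (PontryaginDual G)) := by
  refine ⟨fun hG ↦ ?_, fun hG ↦ ?_⟩
  · have := hG.compactlyCoherentSpace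
    have hcech : IsCechComplete (PontryaginDual G) :=
      hG.isCechComplete_continuousMonoidHom (E := Circle)
    exact ⟨hcech, hcech.isAlmostMetrizable,
      isCompleteTopGroup_continuousMonoidHom (G := G) (E := Circle)⟩
  · have := hG.compactlyCoherentSpace
    exact ⟨hG.isLocallyKOmegaSpace_continuousMonoidHom,
      isCompleteTopGroup_continuousMonoidHom (G := G) (E := Circle)⟩

theorem mainTheorem5 (G : Type*) [CommGroup G] [TopologicalSpace G] [IsTopologicalGroup G] :
    (IsLocallyKOmegaSpace G →
      IsCechComplete (PontryaginDual G) ∧ IsAlmostMetrizable (PontryaginDual G) ∧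
        IsCompleteTopGroup (PontryaginDual G)) ∧
    (IsAlmostMetrizable G →
      IsLocallyKOmegaSpace (PontryaginDual G) ∧ IsCompleteTopGroup (PontryaginDual G)) :=
  mainTheorem5_general G
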